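/- Let $\mathbb K=\mathbb R$ or $\mathbb C$; all Banach spaces are over $\mathbb K$, and operators are bounded and linear. A Banach space $X$ has the bounded approximation property (BAP) if there is a constant $\lambda$ such that for every finite-dimensional subspace $F\subseteq X$ there is a finite-rank operator $T:X\to X$ with $\|T\|\le\lambda$ and $T(f)=f$ for all $f\in F$. A Banach space $X$ is an $\mathcal L_1$-space if there is a constant $\lambda$ such that every finite-dimensional subspace of $X$ is contained in a finite-dimensional subspace $F\subseteq X$ for which there is a linear isomorphism $e:F\to\ell_1^n$, $n=\dim F$, with $\|e\|\,\|e^{-1}\|\le\lambda$. Let $0\to Y\to\mathcal L_1\to Z\to 0$ and $0\to Y'\to\mathcal L_1'\to Z\to 0$ be two exact sequences of Banach spaces and operators, with the same quotient space $Z$, in which $\mathcal L_1$ and $\mathcal L_1'$ are arbitrary (possibly different) $\mathcal L_1$-spaces. Then $Y$ has the BAP if and only if $Y'$ has the BAP. -/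

import Mathlib

/-- `X` has the `lam`-bounded approximation property: for each finite-dimensional subspace `F` of
`X` there is a finite-rank bounded operator `T : X → X` with `‖T‖ ≤ lam` that is the identity
on `F`. -/
def HasLambdaBAP (𝕜 : Type*) [RCLike 𝕜] (X : Type*) [NormedAddCommGroup X] [NormedSpace 𝕜 X]
    (lam : ℝ) : Prop :=
  ∀ F : Submodule 𝕜 X, FiniteDimensional 𝕜 F →
    ∃ T : X →L[𝕜] X,
      FiniteDimensional 𝕜 (LinearMap.range (T : X →ₗ[𝕜] X)) ∧ ‖T‖ ≤ lam ∧ ∀ f ∈ F, T f = f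

/-- The bounded approximation property (BAP). -/
def HasBAP (𝕜 : Type*) [RCLike 𝕜] (X : Type*) [NormedAddCommGroup X] [NormedSpace 𝕜 X] : Prop :=
  ∃ lam : ℝ, HasLambdaBAP 𝕜 X lam

/-- `X` is an `𝓛_{1,lam}`-space: every finite-dimensional subspace `E` of `X` is contained in a
finite-dimensional subspace `F` of `X` that admits an isomorphism `e` onto some `ℓ₁ⁿ` (so that
`n = dim F`) with `‖e‖ * ‖e⁻¹‖ ≤ lam`. -/
def IsScriptL1Lambda (𝕜 : Type*) [RCLike 𝕜] (X : Type*) [NormedAddCommGroup X] [NormedSpace 𝕜 X]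
    (lam : ℝ) : Prop :=
  ∀ E : Submodule 𝕜 X, FiniteDimensional 𝕜 E →
    ∃ F : Submodule 𝕜 X, E ≤ F ∧ ∃ (n : ℕ) (e : F ≃L[𝕜] PiLp 1 (fun _ : Fin n => 𝕜)),
      ‖(e : F →L[𝕜] PiLp 1 (fun _ : Fin n => 𝕜))‖ *
        ‖(e.symm : PiLp 1 (fun _ : Fin n => 𝕜) →L[𝕜] F)‖ ≤ lam

/-- `X` is an `𝓛₁`-space if it is an `𝓛_{1,lam}`-space for some `lam`. -/
def IsScriptL1 (𝕜 : Type*) [RCLike 𝕜] (X : Type*) [NormedAddCommGroup X] [NormedSpace 𝕜 X] :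
    Prop :=
  ∃ lam : ℝ, IsScriptL1Lambda 𝕜 X lam

/-- The sequence `0 → Y → X → Z → 0` of bounded operators is exact: `i` is injective, the image of
`i` is the kernel of `q`, and `q` is surjective. -/
def IsShortExactSeq {𝕜 : Type*} [RCLike 𝕜] {Y X Z : Type*}
    [NormedAddCommGroup Y] [NormedSpace 𝕜 Y] [NormedAddCommGroup X] [NormedSpace 𝕜 X]
    [NormedAddCommGroup Z] [NormedSpace 𝕜 Z] (i : Y →L[𝕜] X) (q : X →L[𝕜] Z) : Prop :=
  Function.Injective i ∧ Function.Exact i q ∧ Function.Surjective q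

/-! The pullback `B` of `q` and `q'` is a Banach space containing both kernels: `0 → Y → B → L' → 0`
and `0 → Y' → B → L → 0` are exact. Since `ℓ₁ⁿ` lifts through surjections with a constant
independent of `n`, a sequence with `𝓛₁` quotient splits locally with uniform bounds. Hence the BAP
climbs from `Y` to `B` (`hasBAP_middle`, which also uses that `𝓛₁`-spaces have the BAP) and descends
from `B` to `Y'` (`hasBAP_left`). The converse follows by symmetry. -/

open Filter Topology

/-! ### Gluing and factoring local operators. -/

/-- Balls of `G` are compact, so the `φ s` converge pointwise along an ultrafilter finer than
`atTop`. The limit is linear and, unlike the `φ s`, bounded everywhere. -/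
theorem exists_clm_of_locally_bounded {𝕜 X G : Type*} [RCLike 𝕜]
    [NormedAddCommGroup X] [NormedSpace 𝕜 X]
    [NormedAddCommGroup G] [NormedSpace 𝕜 G] [FiniteDimensional 𝕜 G] {C : ℝ} (hC : 0 ≤ C)
    (φ : Finset X → X →ₗ[𝕜] G) (hφ : ∀ s, ∀ x ∈ s, ‖φ s x‖ ≤ C * ‖x‖) :
    ∃ T : X →L[𝕜] G, ‖T‖ ≤ C ∧
      ∀ (s : Finset X) (ε : ℝ), 0 < ε → ∃ t, s ⊆ t ∧ ∀ x ∈ s, ‖T x - φ t x‖ < ε := by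
  classical
  have : ProperSpace G := FiniteDimensional.proper 𝕜 G
  let U : Ultrafilter (Finset X) := Ultrafilter.of atTop
  have hU : (U : Filter (Finset X)) ≤ atTop := Ultrafilter.of_le _
  have hmem : ∀ x, ∀ᶠ s in (U : Filter (Finset X)), φ s x ∈ Metric.closedBall (0 : G) (C * ‖x‖) :=
    fun x => hU ((eventually_ge_atTop {x}).mono fun s hs => by
      simpa using hφ s x (by simpa using hs))
  have hlim : ∀ x, ∃ y ∈ Metric.closedBall (0 : G) (C * ‖x‖),
      Tendsto (fun s => φ s x) (U : Filter (Finset X)) (𝓝 y) := fun x =>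
    (isCompact_closedBall (0 : G) (C * ‖x‖)).ultrafilter_le_nhds' (U.map fun s => φ s x) (hmem x)
  choose T hTb hT using hlim
  let T₀ : X →ₗ[𝕜] G :=
    { toFun := T
      map_add' := fun x y => tendsto_nhds_unique (hT (x + y)) (by
        simpa using (hT x).add (hT y))
      map_smul' := fun c x => tendsto_nhds_unique (hT (c • x)) (by
        simpa using (hT x).const_smul c) }
  refine ⟨T₀.mkContinuous C fun x => mem_closedBall_zero_iff.1 (hTb x),
    LinearMap.mkContinuous_norm_le _ hC _, fun s ε hε => ?_⟩
  have h1 : ∀ᶠ t in (U : Filter (Finset X)), ∀ x ∈ s, ‖T x - φ t x‖ < ε := by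
    rw [Finset.eventually_all]
    intro x _
    filter_upwards [Metric.tendsto_nhds.1 (hT x) ε hε] with t ht
    rwa [dist_comm, dist_eq_norm] at ht
  have h2 : ∀ᶠ t in (U : Filter (Finset X)), s ≤ t := hU (eventually_ge_atTop s)
  obtain ⟨t, ht, ht'⟩ := (h2.and h1).exists
  exact ⟨t, ht, ht'⟩

/-- Factorization of the identity on a finite-dimensional part of an `𝓛₁`-space through `ℓ₁ⁿ`. -/
theorem IsScriptL1Lambda.exists_factorization {𝕜 X : Type*} [RCLike 𝕜]
    [NormedAddCommGroup X] [NormedSpace 𝕜 X] {lam : ℝ} (h : IsScriptL1Lambda 𝕜 X lam)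
    (E : Submodule 𝕜 X) [FiniteDimensional 𝕜 E] :
    ∃ (n : ℕ) (a : X →ₗ[𝕜] PiLp 1 (fun _ : Fin n => 𝕜)) (b : PiLp 1 (fun _ : Fin n => 𝕜) →L[𝕜] X),
      ‖b‖ ≤ 1 ∧ ∀ x ∈ E, ‖a x‖ ≤ lam * ‖x‖ ∧ b (a x) = x := by
  obtain ⟨F, hEF, n, e, he⟩ := h E inferInstance
  obtain ⟨a, ha⟩ := LinearMap.exists_extend (p := F) e.toLinearEquiv.toLinearMap
  have ha' : ∀ x (hx : x ∈ F), a x = e ⟨x, hx⟩ := fun x hx => LinearMap.congr_fun ha ⟨x, hx⟩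
  set β : ℝ := ‖(e.symm : PiLp 1 (fun _ : Fin n => 𝕜) →L[𝕜] F)‖ with hβ
  have hβ0 : 0 ≤ β := norm_nonneg _
  -- Rescaling by `β` makes `b` a contraction and leaves the whole constant to `a`. If `β = 0`, then
  -- `F` is trivial.
  refine ⟨n, (β : 𝕜) • a,
    ((β : 𝕜)⁻¹) • (F.subtypeL ∘L (e.symm : PiLp 1 (fun _ : Fin n => 𝕜) →L[𝕜] F)), ?_,
    fun x hx => ⟨?_, ?_⟩⟩
  · refine ContinuousLinearMap.opNorm_le_bound _ zero_le_one fun v => ?_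
    have h1 : ‖e.symm v‖ ≤ β * ‖v‖ :=
      (e.symm : PiLp 1 (fun _ : Fin n => 𝕜) →L[𝕜] F).le_opNorm v
    have h2 : ‖(e.symm v : X)‖ ≤ β * ‖v‖ := h1
    simp only [smul_apply, ContinuousLinearMap.comp_apply, norm_smul, norm_inv,
      RCLike.norm_ofReal, abs_of_nonneg hβ0]
    rcases hβ0.eq_or_lt with h0 | h0
    · simp [← h0]
    · rw [inv_mul_le_iff₀ h0]
      simpa using h2
  · have h1 : ‖e ⟨x, hEF hx⟩‖ ≤ ‖(e : F →L[𝕜] PiLp 1 (fun _ : Fin n => 𝕜))‖ * ‖x‖ :=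
      (e : F →L[𝕜] PiLp 1 (fun _ : Fin n => 𝕜)).le_opNorm ⟨x, hEF hx⟩
    simp only [LinearMap.smul_apply, norm_smul, RCLike.norm_ofReal, abs_of_nonneg hβ0,
      ha' x (hEF hx)]
    calc _ ≤ β * (‖(e : F →L[𝕜] PiLp 1 (fun _ : Fin n => 𝕜))‖ * ‖x‖) := by gcongr
      _ = (‖(e : F →L[𝕜] PiLp 1 (fun _ : Fin n => 𝕜))‖ * β) * ‖x‖ := by ring
      _ ≤ lam * ‖x‖ := by gcongr
  · rcases hβ0.eq_or_lt with h0 | h0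
    · have h1 : ‖e.symm (e ⟨x, hEF hx⟩)‖ ≤ β * ‖e ⟨x, hEF hx⟩‖ :=
        (e.symm : PiLp 1 (fun _ : Fin n => 𝕜) →L[𝕜] F).le_opNorm _
      have h2 : ‖x‖ ≤ 0 := by simpa [← h0] using h1
      have h3 : x = 0 := norm_le_zero_iff.1 h2
      simp [h3]
    · have : (β : 𝕜) ≠ 0 := by exact_mod_cast h0.ne'
      have h1 : ((β : 𝕜)⁻¹) • (e.symm ((β : 𝕜) • e ⟨x, hEF hx⟩) : X) = x := by
        rw [map_smul, Submodule.coe_smul, smul_smul, inv_mul_cancel₀ this, one_smul,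
          e.symm_apply_apply]
      simpa [-smul_apply, ha' x (hEF hx)] using h1

theorem IsScriptL1.exists_pos {𝕜 X : Type*} [RCLike 𝕜]
    [NormedAddCommGroup X] [NormedSpace 𝕜 X] (h : IsScriptL1 𝕜 X) :
    ∃ lam : ℝ, 0 ≤ lam ∧ IsScriptL1Lambda 𝕜 X lam := by
  obtain ⟨lam, h⟩ := h
  refine ⟨lam, ?_, h⟩
  obtain ⟨F, -, n, e, he⟩ := h ⊥ inferInstance
  exact le_trans (by positivity) he

/-! ### The BAP of `𝓛₁`-spaces. -/

/-- Finitely many vectors of `ℓ₁(N)` are almost fixed by a contraction factoring through a space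
`ℓ₁(M)`, where `M` depends on the number of vectors and the precision, but not on `N`. -/
theorem exists_finite_conditional_expectation (𝕜 : Type*) [RCLike 𝕜] (k : ℕ) {ε : ℝ} (hε : 0 < ε) :
    ∃ t : Finset (Fin k → 𝕜), ∀ (n : ℕ) (x : Fin k → PiLp 1 (fun _ : Fin n => 𝕜)),
      ∃ (A : PiLp 1 (fun _ : Fin n => 𝕜) →L[𝕜] PiLp 1 (fun _ : t => 𝕜))
        (B : PiLp 1 (fun _ : t => 𝕜) →L[𝕜] PiLp 1 (fun _ : Fin n => 𝕜)),
        ‖A‖ ≤ 1 ∧ ‖B‖ ≤ 1 ∧ ∀ i, ‖B (A (x i)) - x i‖ ≤ 2 * ε * ∑ j, ‖x j‖ := by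
  classical
  obtain ⟨t₀, -, ht₀, hcov⟩ :=
    (isCompact_closedBall (0 : Fin k → 𝕜) 1).finite_cover_balls hε
  refine ⟨ht₀.toFinset, fun n x => ?_⟩
  set t := ht₀.toFinset
  -- After division by the density `H`, the vectors take values in the unit ball of `𝕜^k`. An
  -- `ε`-net there, independent of `n`, cuts the coordinates into cells: `A₀` sums over a cell, `B₀`
  -- redistributes in proportion to `H`.
  let H : Fin n → ℝ := fun ω => ∑ j, ‖x j ω‖
  have hH : ∀ ω, 0 ≤ H ω := fun ω => by positivity
  have hxH : ∀ i ω, ‖x i ω‖ ≤ H ω := fun i ω =>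
    Finset.single_le_sum (f := fun j => ‖x j ω‖) (fun _ _ => norm_nonneg _) (Finset.mem_univ i)
  let v : Fin n → Fin k → 𝕜 := fun ω i => ((H ω : ℝ) : 𝕜)⁻¹ * x i ω
  have hv : ∀ i ω, x i ω = (H ω : 𝕜) * v ω i := by
    intro i ω
    rcases (hH ω).eq_or_lt with h0 | h0
    · have : x i ω = 0 := norm_le_zero_iff.1 (h0 ▸ hxH i ω)
      simp [v, this]
    · have : (H ω : 𝕜) ≠ 0 := by exact_mod_cast h0.ne'
      simp [v, this]
  have hcell : ∀ ω, ∃ c : t, ∀ i, ‖v ω i - c.1 i‖ ≤ ε := by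
    intro ω
    have h1 : v ω ∈ Metric.closedBall (0 : Fin k → 𝕜) 1 := by
      rw [mem_closedBall_zero_iff, pi_norm_le_iff_of_nonneg zero_le_one]
      intro i
      simp only [v, norm_mul, norm_inv, RCLike.norm_ofReal, abs_of_nonneg (hH ω)]
      exact inv_mul_le_one_of_le₀ (hxH i ω) (hH ω)
    obtain ⟨c, hc, hvc⟩ := Set.mem_iUnion₂.1 (hcov h1)
    refine ⟨⟨c, ht₀.mem_toFinset.2 hc⟩, fun i => ?_⟩
    rw [Metric.mem_ball, dist_eq_norm] at hvc
    exact (norm_le_pi_norm (v ω - c) i).trans hvc.le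
  choose c hc using hcell
  let m : t → ℝ := fun d => ∑ ω with c ω = d, H ω
  have hm : ∀ d, 0 ≤ m d := fun d => Finset.sum_nonneg fun ω _ => hH ω
  let A₀ : PiLp 1 (fun _ : Fin n => 𝕜) →ₗ[𝕜] PiLp 1 (fun _ : t => 𝕜) :=
    { toFun := fun f => WithLp.toLp 1 fun d => ∑ ω with c ω = d, f ω
      map_add' := fun f g => by ext d; simp [Finset.sum_add_distrib]
      map_smul' := fun r f => by ext d; simp [Finset.mul_sum] }
  let B₀ : PiLp 1 (fun _ : t => 𝕜) →ₗ[𝕜] PiLp 1 (fun _ : Fin n => 𝕜) :=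
    { toFun := fun g => WithLp.toLp 1 fun ω => (H ω : 𝕜) * ((m (c ω) : 𝕜)⁻¹ * g (c ω))
      map_add' := fun f g => by ext d; simp [mul_add]
      map_smul' := fun r f => by ext d; simp; ring }
  have hA : ∀ f, ‖A₀ f‖ ≤ 1 * ‖f‖ := by
    intro f
    rw [one_mul, PiLp.norm_eq_of_L1, PiLp.norm_eq_of_L1]
    calc ∑ d, ‖∑ ω with c ω = d, f ω‖ ≤ ∑ d, ∑ ω with c ω = d, ‖f ω‖ :=
          Finset.sum_le_sum fun d _ => norm_sum_le _ _
      _ = ∑ ω, ‖f ω‖ := Finset.sum_fiberwise _ _ _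
  have hB : ∀ g, ‖B₀ g‖ ≤ 1 * ‖g‖ := by
    intro g
    rw [one_mul, PiLp.norm_eq_of_L1, PiLp.norm_eq_of_L1]
    calc ∑ ω, ‖(H ω : 𝕜) * ((m (c ω) : 𝕜)⁻¹ * g (c ω))‖
        = ∑ ω, H ω * ((m (c ω))⁻¹ * ‖g (c ω)‖) := by
          refine Finset.sum_congr rfl fun ω _ => ?_
          simp [abs_of_nonneg (hH ω), abs_of_nonneg (hm _)]
      _ = ∑ d, ∑ ω with c ω = d, H ω * ((m (c ω))⁻¹ * ‖g (c ω)‖) :=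
          (Finset.sum_fiberwise _ _ _).symm
      _ = ∑ d, m d * ((m d)⁻¹ * ‖g d‖) := by
          refine Finset.sum_congr rfl fun d _ => ?_
          rw [Finset.sum_mul]
          refine Finset.sum_congr rfl fun ω hω => ?_
          rw [(Finset.mem_filter.1 hω).2]
      _ ≤ ∑ d, ‖g d‖ := by
          refine Finset.sum_le_sum fun d _ => ?_
          rw [← mul_assoc]
          exact mul_le_of_le_one_left (norm_nonneg _) mul_inv_le_one
  refine ⟨A₀.mkContinuous 1 hA, B₀.mkContinuous 1 hB, LinearMap.mkContinuous_norm_le _ zero_le_one _,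
    LinearMap.mkContinuous_norm_le _ zero_le_one _, fun i => ?_⟩
  have hpt : ∀ ω, ‖(B₀ (A₀ (x i)) - x i) ω‖ ≤ 2 * ε * H ω := by
    intro ω
    change ‖(H ω : 𝕜) * ((m (c ω) : 𝕜)⁻¹ * ∑ ω' with c ω' = c ω, x i ω') - x i ω‖ ≤ _
    rcases (hH ω).eq_or_lt with h0 | h0
    · have : x i ω = 0 := norm_le_zero_iff.1 (h0 ▸ hxH i ω)
      simp [this, ← h0]
    have hmpos : 0 < m (c ω) := h0.trans_le
      (Finset.single_le_sum (f := H) (fun ω' _ => hH ω') (by simp))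
    have hm0 : (m (c ω) : 𝕜) ≠ 0 := by exact_mod_cast hmpos.ne'
    -- Within a cell, `v` varies by at most `2 * ε`, since all its values are `ε`-close to the same
    -- net point.
    have key : ‖(∑ ω' with c ω' = c ω, x i ω') - (m (c ω) : 𝕜) * v ω i‖ ≤ m (c ω) * (2 * ε) := by
      have : (m (c ω) : 𝕜) * v ω i = ∑ ω' with c ω' = c ω, (H ω' : 𝕜) * v ω i := by
        simp only [m]
        push_cast
        rw [Finset.sum_mul]
      rw [this, ← Finset.sum_sub_distrib, Finset.sum_mul]
      refine norm_sum_le_of_le _ fun ω' hω' => ?_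
      rw [hv i ω', ← mul_sub, norm_mul, RCLike.norm_ofReal, abs_of_nonneg (hH ω')]
      refine mul_le_mul_of_nonneg_left ?_ (hH ω')
      have h1 := hc ω' i
      rw [(Finset.mem_filter.1 hω').2] at h1
      have h2 := hc ω i
      calc ‖v ω' i - v ω i‖ = ‖(v ω' i - (c ω).1 i) - (v ω i - (c ω).1 i)‖ := by
            congr 1; ring
        _ ≤ ε + ε := (norm_sub_le _ _).trans (add_le_add h1 h2)
        _ = 2 * ε := by ring
    have heq : (H ω : 𝕜) * ((m (c ω) : 𝕜)⁻¹ * ∑ ω' with c ω' = c ω, x i ω') - x i ω =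
        (H ω : 𝕜) * ((m (c ω) : 𝕜)⁻¹ *
          ((∑ ω' with c ω' = c ω, x i ω') - (m (c ω) : 𝕜) * v ω i)) := by
      rw [hv i ω]
      field_simp
    rw [heq, norm_mul, norm_mul, norm_inv, RCLike.norm_ofReal, RCLike.norm_ofReal,
      abs_of_nonneg (hH ω), abs_of_nonneg (hm _), mul_comm (2 * ε)]
    refine mul_le_mul_of_nonneg_left ?_ (hH ω)
    rwa [inv_mul_le_iff₀ hmpos]
  change ‖B₀ (A₀ (x i)) - x i‖ ≤ _
  rw [PiLp.norm_eq_of_L1]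
  calc _ ≤ ∑ ω, 2 * ε * H ω := Finset.sum_le_sum fun ω _ => hpt ω
    _ = 2 * ε * ∑ j, ‖x j‖ := by
      simp only [H, PiLp.norm_eq_of_L1]
      rw [← Finset.mul_sum, Finset.sum_comm]

/-- The error of `S` on a basis of `F` is removed by a finite-rank correction built from bounded
extensions of the coordinate functionals; precision `(K + 1)⁻¹` keeps its norm at most `1`. -/
theorem hasLambdaBAP_of_approx {𝕜 X : Type*} [RCLike 𝕜]
    [NormedAddCommGroup X] [NormedSpace 𝕜 X] {lam : ℝ}
    (h : ∀ (k : ℕ) (x : Fin k → X) (ε : ℝ), 0 < ε → ∃ S : X →L[𝕜] X,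
      FiniteDimensional 𝕜 (LinearMap.range (S : X →ₗ[𝕜] X)) ∧ ‖S‖ ≤ lam ∧
        ∀ i, ‖S (x i) - x i‖ ≤ ε) :
    HasLambdaBAP 𝕜 X (lam + 1) := by
  intro F hF
  obtain ⟨P, hP⟩ := Submodule.ClosedComplemented.of_finiteDimensional F
  let bF := Module.finBasis 𝕜 F
  let f : Fin (Module.finrank 𝕜 F) → X →L[𝕜] 𝕜 := fun i =>
    (LinearMap.toContinuousLinearMap (bF.coord i)) ∘L P
  let K : ℝ := ∑ i, ‖f i‖
  have hK : 0 ≤ K := by positivity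
  obtain ⟨S, hSf, hS, hSx⟩ := h _ (fun i => (bF i : X)) (K + 1)⁻¹ (by positivity)
  refine ⟨S + ∑ i, (f i).smulRight ((bF i : X) - S (bF i)), ?_, ?_, ?_⟩
  · let R : Submodule 𝕜 X := LinearMap.range (S : X →ₗ[𝕜] X) ⊔ F
    have : FiniteDimensional 𝕜 R := Submodule.finiteDimensional_sup _ _
    refine Submodule.finiteDimensional_of_le (S₂ := R) ?_
    rintro _ ⟨z, rfl⟩
    have hr : ∀ z, S z ∈ R := fun z => Submodule.mem_sup_left ⟨z, rfl⟩
    have hf : ∀ i, (bF i : X) ∈ R := fun i => Submodule.mem_sup_right (bF i).2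
    simp only [ContinuousLinearMap.coe_coe, add_apply,
      sum_apply, ContinuousLinearMap.smulRight_apply]
    exact R.add_mem (hr z) (R.sum_mem fun i _ => R.smul_mem _ (R.sub_mem (hf i) (hr _)))
  · refine (norm_add_le _ _).trans (add_le_add hS ?_)
    calc _ ≤ ∑ i, ‖f i‖ * (K + 1)⁻¹ := by
          refine norm_sum_le_of_le _ fun i _ => ?_
          rw [ContinuousLinearMap.norm_smulRight_apply, norm_sub_rev]
          exact mul_le_mul_of_nonneg_left (hSx i) (norm_nonneg _)
      _ = K * (K + 1)⁻¹ := by rw [← Finset.sum_mul]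
      _ ≤ 1 := by
          rw [← div_eq_mul_inv, div_le_one (by positivity)]
          linarith
  · intro z hz
    have h1 : ∑ i, f i z • (bF i : X) = z := by
      have := bF.sum_repr ⟨z, hz⟩
      have h2 := congrArg (Subtype.val) this
      simp only [Submodule.coe_sum, Submodule.coe_smul] at h2
      rw [← h2]
      refine Finset.sum_congr rfl fun i _ => ?_
      have : P z = ⟨z, hz⟩ := hP ⟨z, hz⟩
      simp only [f, ContinuousLinearMap.comp_apply, h2, this]
      rfl
    simp only [add_apply, sum_apply,
      ContinuousLinearMap.smulRight_apply, smul_sub, Finset.sum_sub_distrib]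
    rw [h1]
    have h3 : ∑ i, f i z • S (bF i : X) = S z := by
      conv_rhs => rw [← h1]
      simp
    rw [h3]
    abel

/-- The local factorizations all pass through the same space `ℓ₁(t)`, so the maps into it have a
bounded limit `T`. One `ψ s` with `φ s` close to `T` on the given vectors then suffices. -/
theorem IsScriptL1.hasBAP {𝕜 X : Type*} [RCLike 𝕜]
    [NormedAddCommGroup X] [NormedSpace 𝕜 X] (h : IsScriptL1 𝕜 X) : HasBAP 𝕜 X := by
  classical
  obtain ⟨lam, hlam, h⟩ := h.exists_pos
  refine ⟨lam + 1, hasLambdaBAP_of_approx fun k x ε hε => ?_⟩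
  let K : ℝ := ∑ j, ‖x j‖
  have hK : 0 ≤ K := by positivity
  let η : ℝ := ε / 2 / (2 * (lam * K + 1))
  have hη : 0 < η := by positivity
  obtain ⟨t, ht⟩ := exists_finite_conditional_expectation 𝕜 k hη
  have hloc : ∀ s : Finset X, ∃ (φ : X →ₗ[𝕜] PiLp 1 (fun _ : t => 𝕜))
      (ψ : PiLp 1 (fun _ : t => 𝕜) →L[𝕜] X), (∀ z ∈ s, ‖φ z‖ ≤ lam * ‖z‖) ∧ ‖ψ‖ ≤ 1 ∧
        ∀ i, ‖ψ (φ (x i)) - x i‖ ≤ ε / 2 := by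
    intro s
    let s' : Finset X := s ∪ Finset.univ.image x
    obtain ⟨n, a, b, hb, hab⟩ := h.exists_factorization (Submodule.span 𝕜 (s' : Set X))
    have hs' : ∀ z ∈ s', z ∈ Submodule.span 𝕜 (s' : Set X) := fun z hz => Submodule.subset_span hz
    have hxs : ∀ i, x i ∈ s' := fun i => by simp [s']
    obtain ⟨A, B, hA, hB, hAB⟩ := ht n fun i => a (x i)
    refine ⟨(A : _ →ₗ[𝕜] _) ∘ₗ a, b ∘L B, fun z hz => ?_, ?_, fun i => ?_⟩
    · exact (A.le_of_opNorm_le hA _).trans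
        (by simpa using (hab z (hs' z (Finset.mem_union_left _ hz))).1)
    · exact (b.opNorm_comp_le B).trans (mul_le_one₀ hb (norm_nonneg _) hB)
    · have h1 : ‖B (A (a (x i))) - a (x i)‖ ≤ ε / 2 := by
        calc _ ≤ 2 * η * ∑ j, ‖a (x j)‖ := hAB i
          _ ≤ 2 * η * ∑ j, lam * ‖x j‖ := by
            gcongr with j
            exact (hab _ (hs' _ (hxs j))).1
          _ = ε / 2 * ((lam * K) / (lam * K + 1)) := by
            rw [← Finset.mul_sum]
            have : lam * K + 1 ≠ 0 := by positivity
            simp only [η]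
            change 2 * (ε / 2 / (2 * (lam * K + 1))) * (lam * K) = _
            field_simp
          _ ≤ ε / 2 * 1 := by
            gcongr
            rw [div_le_one (by positivity)]
            linarith
          _ = ε / 2 := mul_one _
      calc ‖b (B (A (a (x i)))) - x i‖ = ‖b (B (A (a (x i))) - a (x i))‖ := by
            rw [map_sub, (hab _ (hs' _ (hxs i))).2]
        _ ≤ 1 * ‖B (A (a (x i))) - a (x i)‖ := b.le_of_opNorm_le hb _
        _ ≤ ε / 2 := by rwa [one_mul]
  choose φ ψ hφ hψ hφψ using hloc
  obtain ⟨T, hT, hTs⟩ := exists_clm_of_locally_bounded hlam φ hφ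
  obtain ⟨s, -, hs⟩ := hTs (Finset.univ.image x) (ε / 2) (by positivity)
  refine ⟨ψ s ∘L T, ?_, ?_, fun i => ?_⟩
  · have : FiniteDimensional 𝕜 (LinearMap.range (ψ s : PiLp 1 (fun _ : t => 𝕜) →ₗ[𝕜] X)) :=
      inferInstance
    refine Submodule.finiteDimensional_of_le
      (S₂ := LinearMap.range (ψ s : PiLp 1 (fun _ : t => 𝕜) →ₗ[𝕜] X)) ?_
    rintro _ ⟨z, rfl⟩
    exact ⟨T z, rfl⟩
  · calc _ ≤ ‖ψ s‖ * ‖T‖ := (ψ s).opNorm_comp_le T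
      _ ≤ 1 * lam := by
        gcongr
        exact hψ s
      _ = lam := one_mul _
  · have h1 : ‖ψ s (T (x i) - φ s (x i))‖ ≤ ε / 2 := by
      refine ((ψ s).le_of_opNorm_le (hψ s) _).trans ?_
      rw [one_mul]
      exact (hs (x i) (by simp)).le
    calc ‖ψ s (T (x i)) - x i‖
        = ‖ψ s (T (x i) - φ s (x i)) + (ψ s (φ s (x i)) - x i)‖ := by
          rw [map_sub]; congr 1; abel
      _ ≤ ε / 2 + ε / 2 := (norm_add_le _ _).trans (add_le_add h1 (hφψ s i))
      _ = ε := by ring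

/-! ### Exact sequences with `𝓛₁` quotient. -/

/-- `ℓ₁ⁿ` has the lifting property, with a constant that does not depend on `n`. -/
theorem exists_lift_of_surjective {𝕜 X W : Type*} [RCLike 𝕜]
    [NormedAddCommGroup X] [NormedSpace 𝕜 X] [CompleteSpace X]
    [NormedAddCommGroup W] [NormedSpace 𝕜 W] [CompleteSpace W]
    (q : X →L[𝕜] W) (hq : Function.Surjective q) :
    ∃ C : ℝ, 0 ≤ C ∧ ∀ (n : ℕ) (b : PiLp 1 (fun _ : Fin n => 𝕜) →L[𝕜] W),
      ∃ l : PiLp 1 (fun _ : Fin n => 𝕜) →L[𝕜] X, (∀ v, q (l v) = b v) ∧ ‖l‖ ≤ C * ‖b‖ := by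
  classical
  obtain ⟨C, hC, hpre⟩ := q.exists_preimage_norm_le hq
  refine ⟨C, hC.le, fun n b => ?_⟩
  let e : Fin n → PiLp 1 (fun _ : Fin n => 𝕜) := fun j => WithLp.toLp 1 (Pi.single j 1)
  have he : ∀ j, ‖e j‖ ≤ 1 := fun j => by
    simp [e]
  have hsum : ∀ v : PiLp 1 (fun _ : Fin n => 𝕜), v = ∑ j, v j • e j := fun v => by
    ext i
    simp [e, Pi.single_apply]
  choose x hxq hx using fun j => hpre (b (e j))
  let l : PiLp 1 (fun _ : Fin n => 𝕜) →ₗ[𝕜] X :=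
    { toFun := fun v => ∑ j, v j • x j
      map_add' := fun v w => by simp [add_smul, Finset.sum_add_distrib]
      map_smul' := fun c v => by simp [mul_smul, Finset.smul_sum] }
  refine ⟨l.mkContinuous (C * ‖b‖) fun v => ?_, fun v => ?_,
    LinearMap.mkContinuous_norm_le _ (by positivity) _⟩
  · rw [PiLp.norm_eq_of_L1, Finset.mul_sum]
    change ‖∑ j, v j • x j‖ ≤ _
    refine norm_sum_le_of_le _ fun j _ => ?_
    rw [norm_smul, mul_comm]
    refine mul_le_mul_of_nonneg_right ((hx j).trans ?_) (norm_nonneg _)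
    exact mul_le_mul_of_nonneg_left (b.unit_le_opNorm _ (he j)) hC.le
  · change q (∑ j, v j • x j) = b v
    conv_rhs => rw [hsum v]
    simp [hxq]

/-- A subspace with `𝓛₁` quotient is locally complemented. -/
theorem IsShortExactSeq.exists_local_projection {𝕜 Y X W : Type*} [RCLike 𝕜]
    [NormedAddCommGroup Y] [NormedSpace 𝕜 Y] [CompleteSpace Y]
    [NormedAddCommGroup X] [NormedSpace 𝕜 X] [CompleteSpace X]
    [NormedAddCommGroup W] [NormedSpace 𝕜 W] [CompleteSpace W]
    {i : Y →L[𝕜] X} {q : X →L[𝕜] W} (h : IsShortExactSeq i q) (hW : IsScriptL1 𝕜 W) :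
    ∃ C : ℝ, 0 ≤ C ∧ ∀ E : Submodule 𝕜 X, FiniteDimensional 𝕜 E →
      ∃ P : X →ₗ[𝕜] Y, (∀ y, P (i y) = y) ∧ ∀ x ∈ E, ‖P x‖ ≤ C * ‖x‖ := by
  obtain ⟨hi, hex, hq⟩ := h
  obtain ⟨lam, hlam, hW⟩ := hW.exists_pos
  obtain ⟨C, hC, hlift⟩ := exists_lift_of_surjective q hq
  obtain ⟨r, hr⟩ := (i : Y →ₗ[𝕜] X).exists_leftInverse_of_injective (LinearMap.ker_eq_bot.2 hi)
  have hr' : ∀ y, r (i y) = y := fun y => LinearMap.congr_fun hr y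
  have hrange : IsClosed (Set.range i) := by
    have : Set.range i = q ⁻¹' {0} := by
      ext x
      exact (hex x).symm
    rw [this]
    exact isClosed_singleton.preimage q.continuous
  obtain ⟨c, hc⟩ := i.antilipschitz_of_injective_of_isClosed_range hi hrange
  have hc' : ∀ y, ‖y‖ ≤ c * ‖i y‖ := fun y => by
    simpa [dist_eq_norm] using hc.le_mul_dist y 0
  refine ⟨c * (1 + C * (lam * ‖q‖)), by positivity, fun E hE => ?_⟩
  obtain ⟨n, a, b, hb, hab⟩ := hW.exists_factorization (E.map (q : X →ₗ[𝕜] W))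
  obtain ⟨l, hl, hlb⟩ := hlift n b
  -- On `E`, subtracting the lift of `q x` lands in the range of `i`, where the algebraic left
  -- inverse `r` is bounded. Off `E` no bound is claimed.
  refine ⟨r ∘ₗ (LinearMap.id - (l : _ →ₗ[𝕜] X) ∘ₗ a ∘ₗ (q : X →ₗ[𝕜] W)), fun y => ?_,
    fun x hx => ?_⟩
  · have : q (i y) = 0 := hex.apply_apply_eq_zero y
    simp [this, hr']
  · obtain ⟨h1, h2⟩ := hab (q x) (Submodule.mem_map_of_mem hx)
    have h3 : q (x - l (a (q x))) = 0 := by rw [map_sub, hl, h2, sub_self]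
    obtain ⟨y, hy⟩ := (hex _).1 h3
    change ‖r (x - l (a (q x)))‖ ≤ _
    have h4 : ‖l (a (q x))‖ ≤ C * (lam * ‖q‖) * ‖x‖ := by
      have hl1 : ‖l‖ ≤ C := hlb.trans (mul_le_of_le_one_right hC hb)
      calc _ ≤ C * ‖a (q x)‖ := l.le_of_opNorm_le hl1 _
        _ ≤ C * (lam * (‖q‖ * ‖x‖)) := by
          gcongr
          exact h1.trans (mul_le_mul_of_nonneg_left (q.le_opNorm x) hlam)
        _ = _ := by ring
    calc _ = ‖y‖ := by rw [← hy, hr']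
      _ ≤ c * ‖x - l (a (q x))‖ := by rw [← hy]; exact hc' y
      _ ≤ c * (‖x‖ + C * (lam * ‖q‖) * ‖x‖) := by
        gcongr
        exact (norm_sub_le _ _).trans (add_le_add le_rfl h4)
      _ = _ := by ring

/-- The bounded approximation property passes to a subspace with `𝓛₁` quotient. -/
theorem IsShortExactSeq.hasBAP_left {𝕜 Y X W : Type*} [RCLike 𝕜]
    [NormedAddCommGroup Y] [NormedSpace 𝕜 Y] [CompleteSpace Y]
    [NormedAddCommGroup X] [NormedSpace 𝕜 X] [CompleteSpace X]
    [NormedAddCommGroup W] [NormedSpace 𝕜 W] [CompleteSpace W]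
    {i : Y →L[𝕜] X} {q : X →L[𝕜] W} (h : IsShortExactSeq i q) (hW : IsScriptL1 𝕜 W)
    (hX : HasBAP 𝕜 X) : HasBAP 𝕜 Y := by
  obtain ⟨C, hC, hP⟩ := h.exists_local_projection hW
  obtain ⟨lam, hX⟩ := hX
  refine ⟨C * (lam * ‖i‖), fun F hF => ?_⟩
  obtain ⟨T, hTf, hT, hTF⟩ := hX (F.map (i : Y →ₗ[𝕜] X)) inferInstance
  have hlam : 0 ≤ lam := (norm_nonneg _).trans hT
  -- Taking the range of `T` as the controlled subspace makes `P ∘ T` bounded on all of `X`.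
  obtain ⟨P, hPi, hPb⟩ := hP _ hTf
  let S : Y →ₗ[𝕜] Y := P ∘ₗ (T : X →ₗ[𝕜] X) ∘ₗ (i : Y →ₗ[𝕜] X)
  refine ⟨S.mkContinuous (C * (lam * ‖i‖)) fun y => ?_, ?_,
    LinearMap.mkContinuous_norm_le _ (by positivity) _, fun f hf => ?_⟩
  · calc ‖P (T (i y))‖ ≤ C * ‖T (i y)‖ := hPb _ ⟨i y, rfl⟩
      _ ≤ C * (lam * (‖i‖ * ‖y‖)) := by
        gcongr
        exact (T.le_of_opNorm_le hT _).trans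
          (mul_le_mul_of_nonneg_left (i.le_opNorm y) hlam)
      _ = _ := by ring
  · refine Submodule.finiteDimensional_of_le
      (S₂ := (LinearMap.range (T : X →ₗ[𝕜] X)).map P) ?_
    rintro _ ⟨y, rfl⟩
    exact ⟨T (i y), ⟨i y, rfl⟩, rfl⟩
  · change P (T (i f)) = f
    have : T (i f) = i f := hTF _ (Submodule.mem_map_of_mem hf)
    rw [this, hPi]

/-- Operators into finite-dimensional spaces extend from a subspace with `𝓛₁` quotient, with
uniform control of the norms. -/
theorem IsShortExactSeq.exists_extension {𝕜 Y X W : Type*} [RCLike 𝕜]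
    [NormedAddCommGroup Y] [NormedSpace 𝕜 Y] [CompleteSpace Y]
    [NormedAddCommGroup X] [NormedSpace 𝕜 X] [CompleteSpace X]
    [NormedAddCommGroup W] [NormedSpace 𝕜 W] [CompleteSpace W]
    {i : Y →L[𝕜] X} {q : X →L[𝕜] W} (h : IsShortExactSeq i q) (hW : IsScriptL1 𝕜 W) :
    ∃ C : ℝ, 0 ≤ C ∧ ∀ (G : Submodule 𝕜 Y) (_ : FiniteDimensional 𝕜 G) (Q : Y →L[𝕜] G),
      ∃ R : X →L[𝕜] G, (∀ y, R (i y) = Q y) ∧ ‖R‖ ≤ C * ‖Q‖ := by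
  obtain ⟨C, hC, hP⟩ := h.exists_local_projection hW
  refine ⟨C, hC, fun G _ Q => ?_⟩
  choose P hPi hPb using fun s : Finset X => hP (Submodule.span 𝕜 (s : Set X)) inferInstance
  obtain ⟨R, hR, hRs⟩ := exists_clm_of_locally_bounded (C := C * ‖Q‖) (by positivity)
    (fun s => (Q : Y →ₗ[𝕜] G) ∘ₗ P s) fun s x hx => by
      calc ‖Q (P s x)‖ ≤ ‖Q‖ * (C * ‖x‖) :=
            Q.le_opNorm_of_le (hPb s x (Submodule.subset_span hx))
        _ = _ := by ring
  refine ⟨R, fun y => ?_, hR⟩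
  refine eq_of_sub_eq_zero (norm_le_zero_iff.1 (le_of_forall_pos_le_add fun ε hε => ?_))
  -- Every approximant `Q ∘ P t` already equals `Q y` at `i y`, so the limit does too.
  obtain ⟨t, -, ht⟩ := hRs {i y} ε hε
  simpa [hPi] using (ht (i y) (by simp)).le

/-- An extension of an `𝓛₁`-space by a space with the bounded approximation property has the
bounded approximation property. -/
theorem IsShortExactSeq.hasBAP_middle {𝕜 Y X W : Type*} [RCLike 𝕜]
    [NormedAddCommGroup Y] [NormedSpace 𝕜 Y] [CompleteSpace Y]
    [NormedAddCommGroup X] [NormedSpace 𝕜 X] [CompleteSpace X]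
    [NormedAddCommGroup W] [NormedSpace 𝕜 W] [CompleteSpace W]
    {i : Y →L[𝕜] X} {q : X →L[𝕜] W} (h : IsShortExactSeq i q) (hW : IsScriptL1 𝕜 W)
    (hY : HasBAP 𝕜 Y) : HasBAP 𝕜 X := by
  obtain ⟨C, hC, hext⟩ := h.exists_extension hW
  obtain ⟨D, hD, hlift⟩ := exists_lift_of_surjective q h.2.2
  obtain ⟨μ, hWB⟩ := hW.hasBAP
  obtain ⟨lam, hlam, hWL⟩ := hW.exists_pos
  obtain ⟨ν, hY⟩ := hY
  obtain ⟨hi, hex, -⟩ := h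
  have hμ : 0 ≤ μ := by
    obtain ⟨T, -, hT, -⟩ := hWB ⊥ inferInstance
    exact (norm_nonneg _).trans hT
  let M : ℝ := D * (lam * (μ * ‖q‖))
  have hM : 0 ≤ M := by positivity
  refine ⟨M + ‖i‖ * (C * ν * (1 + M)), fun F hF => ?_⟩
  obtain ⟨T, hTf, hT, hTF⟩ := hWB (F.map (q : X →ₗ[𝕜] W)) inferInstance
  obtain ⟨n, a, b, hb, hab⟩ := hWL.exists_factorization (LinearMap.range (T : W →ₗ[𝕜] W))
  obtain ⟨l, hl, hlb⟩ := hlift n b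
  have hl1 : ‖l‖ ≤ D := hlb.trans (mul_le_of_le_one_right hD hb)
  -- This lifts `T ∘ q` to `X`; it is bounded because `a` is controlled on the range of `T`.
  let S₀ : X →ₗ[𝕜] X := (l : _ →ₗ[𝕜] X) ∘ₗ a ∘ₗ (T : W →ₗ[𝕜] W) ∘ₗ (q : X →ₗ[𝕜] W)
  let S : X →L[𝕜] X := S₀.mkContinuous M fun x => by
    calc ‖l (a (T (q x)))‖ ≤ D * ‖a (T (q x))‖ := l.le_of_opNorm_le hl1 _
      _ ≤ D * (lam * (μ * (‖q‖ * ‖x‖))) := by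
        gcongr
        refine (hab _ ⟨q x, rfl⟩).1.trans (mul_le_mul_of_nonneg_left ?_ hlam)
        exact (T.le_of_opNorm_le hT _).trans (mul_le_mul_of_nonneg_left (q.le_opNorm x) hμ)
      _ = _ := by simp only [M]; ring
  have hS : ‖S‖ ≤ M := LinearMap.mkContinuous_norm_le _ hM _
  have hSq : ∀ x ∈ F, q (x - S x) = 0 := fun x hx => by
    have h1 : T (q x) = q x := hTF _ (Submodule.mem_map_of_mem hx)
    have h2 : q (S x) = T (q x) := by
      change q (l (a (T (q x)))) = _
      rw [hl]
      exact (hab _ ⟨q x, rfl⟩).2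
    rw [map_sub, h2, h1, sub_self]
  let F' : Submodule 𝕜 X := F.map (LinearMap.id - (S : X →ₗ[𝕜] X))
  let E : Submodule 𝕜 Y := F'.comap (i : Y →ₗ[𝕜] X)
  have hE : FiniteDimensional 𝕜 E :=
    FiniteDimensional.of_injective ((i : Y →ₗ[𝕜] X).restrict (p := E) (q := F') fun _ hy => hy)
      fun x y hxy => Subtype.ext (hi (congrArg Subtype.val hxy))
  obtain ⟨Q, hQf, hQ, hQE⟩ := hY E hE
  have hν : 0 ≤ ν := (norm_nonneg _).trans hQ
  let G : Submodule 𝕜 Y := LinearMap.range (Q : Y →ₗ[𝕜] Y)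
  let Q' : Y →L[𝕜] G := Q.codRestrict G fun y => ⟨y, rfl⟩
  have hQ' : ‖Q'‖ ≤ ν := ContinuousLinearMap.opNorm_le_bound _ hν fun y => Q.le_of_opNorm_le hQ y
  obtain ⟨R, hRi, hR⟩ := hext G hQf Q'
  let V : X →L[𝕜] X := i ∘L G.subtypeL ∘L R
  have hV : ‖V‖ ≤ ‖i‖ * (C * ν) := by
    refine ContinuousLinearMap.opNorm_le_bound _ (by positivity) fun x => ?_
    have h1 : ‖R x‖ ≤ C * ν * ‖x‖ :=
      R.le_of_opNorm_le (hR.trans (mul_le_mul_of_nonneg_left hQ' hC)) x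
    calc ‖i (R x : Y)‖ ≤ ‖i‖ * (C * ν * ‖x‖) := i.le_opNorm_of_le h1
      _ = _ := by ring
  -- For `x ∈ F` the remainder `x - S x` lies in `i(E)`, and `V` fixes it because `R` extends `Q'`
  -- and `Q` is the identity on `E`.
  refine ⟨S + V ∘L (ContinuousLinearMap.id 𝕜 X - S), ?_, ?_, fun x hx => ?_⟩
  · refine Submodule.finiteDimensional_of_le
      (S₂ := LinearMap.range (l : PiLp 1 (fun _ : Fin n => 𝕜) →ₗ[𝕜] X) ⊔ LinearMap.range ((i : Y →ₗ[𝕜] X) ∘ₗ G.subtype)) ?_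
    rintro _ ⟨x, rfl⟩
    exact Submodule.add_mem_sup ⟨a (T (q x)), rfl⟩ ⟨R (x - S x), rfl⟩
  · refine (norm_add_le _ _).trans (add_le_add hS ((V.opNorm_comp_le _).trans ?_))
    calc _ ≤ ‖i‖ * (C * ν) * (1 + M) := by
          gcongr
          exact (norm_sub_le _ _).trans (add_le_add ContinuousLinearMap.norm_id_le hS)
      _ = _ := by ring
  · obtain ⟨y, hy⟩ := (hex _).1 (hSq x hx)
    have hyE : y ∈ E := by
      change i y ∈ F'
      rw [hy]
      exact ⟨x, hx, rfl⟩
    change S x + i (R (x - S x) : Y) = x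
    rw [← hy, hRi]
    change S x + i (Q y) = x
    rw [hQE y hyE, hy]
    abel

/-! ### The pullback argument. -/

theorem HasBAP.of_exact_scriptL1 {𝕜 : Type*} [RCLike 𝕜] {Y Y' L L' Z : Type*}
    [NormedAddCommGroup Y] [NormedSpace 𝕜 Y] [CompleteSpace Y]
    [NormedAddCommGroup Y'] [NormedSpace 𝕜 Y'] [CompleteSpace Y']
    [NormedAddCommGroup L] [NormedSpace 𝕜 L] [CompleteSpace L]
    [NormedAddCommGroup L'] [NormedSpace 𝕜 L'] [CompleteSpace L']
    [NormedAddCommGroup Z] [NormedSpace 𝕜 Z]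
    (hL : IsScriptL1 𝕜 L) (hL' : IsScriptL1 𝕜 L')
    {i : Y →L[𝕜] L} {q : L →L[𝕜] Z} (h : IsShortExactSeq i q)
    {i' : Y' →L[𝕜] L'} {q' : L' →L[𝕜] Z} (h' : IsShortExactSeq i' q')
    (hY : HasBAP 𝕜 Y) : HasBAP 𝕜 Y' := by
  obtain ⟨hi, hex, hq⟩ := h
  obtain ⟨hi', hex', hq'⟩ := h'
  -- the pullback of `q` and `q'`
  let B : Submodule 𝕜 (L × L') := LinearMap.eqLocus
    ((q : L →ₗ[𝕜] Z) ∘ₗ LinearMap.fst 𝕜 L L') ((q' : L' →ₗ[𝕜] Z) ∘ₗ LinearMap.snd 𝕜 L L')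
  have hB : ∀ p : L × L', p ∈ B ↔ q p.1 = q' p.2 := fun p => Iff.rfl
  have hBc : IsClosed (B : Set (L × L')) :=
    isClosed_eq (q.continuous.comp continuous_fst) (q'.continuous.comp continuous_snd)
  have : CompleteSpace B := hBc.completeSpace_coe
  let j : Y →L[𝕜] B := (ContinuousLinearMap.inl 𝕜 L L' ∘L i).codRestrict B fun y => by
    simp [hB, hex.apply_apply_eq_zero y]
  let j' : Y' →L[𝕜] B := (ContinuousLinearMap.inr 𝕜 L L' ∘L i').codRestrict B fun y => by
    simp [hB, hex'.apply_apply_eq_zero y]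
  have hj : IsShortExactSeq j (ContinuousLinearMap.snd 𝕜 L L' ∘L B.subtypeL) := by
    refine ⟨fun x y hxy => hi (congrArg (fun p : B => p.1.1) hxy), fun p => ⟨fun hp => ?_, ?_⟩,
      fun x => ?_⟩
    · have hp' : p.1.2 = 0 := hp
      have hp1 : q p.1.1 = 0 := by rw [(hB _).1 p.2, hp', map_zero]
      obtain ⟨y, hy⟩ := (hex _).1 hp1
      exact ⟨y, Subtype.ext (Prod.ext hy hp'.symm)⟩
    · rintro ⟨y, rfl⟩
      rfl
    · obtain ⟨z, hz⟩ := hq (q' x)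
      exact ⟨⟨(z, x), hz⟩, rfl⟩
  have hj' : IsShortExactSeq j' (ContinuousLinearMap.fst 𝕜 L L' ∘L B.subtypeL) := by
    refine ⟨fun x y hxy => hi' (congrArg (fun p : B => p.1.2) hxy), fun p => ⟨fun hp => ?_, ?_⟩,
      fun x => ?_⟩
    · have hp' : p.1.1 = 0 := hp
      have hp1 : q' p.1.2 = 0 := by rw [← (hB _).1 p.2, hp', map_zero]
      obtain ⟨y, hy⟩ := (hex' _).1 hp1
      exact ⟨y, Subtype.ext (Prod.ext hp'.symm hy)⟩
    · rintro ⟨y, rfl⟩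
      rfl
    · obtain ⟨z, hz⟩ := hq' (q x)
      exact ⟨⟨(x, z), hz.symm⟩, rfl⟩
  exact hj'.hasBAP_left hL (hj.hasBAP_middle hL' hY)

theorem proposition2p3 {𝕜 : Type*} [RCLike 𝕜] {Y Y' L L' Z : Type*}
    [NormedAddCommGroup Y] [NormedSpace 𝕜 Y] [CompleteSpace Y]
    [NormedAddCommGroup Y'] [NormedSpace 𝕜 Y'] [CompleteSpace Y']
    [NormedAddCommGroup L] [NormedSpace 𝕜 L] [CompleteSpace L]
    [NormedAddCommGroup L'] [NormedSpace 𝕜 L'] [CompleteSpace L']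
    [NormedAddCommGroup Z] [NormedSpace 𝕜 Z] [CompleteSpace Z]
    (hL : IsScriptL1 𝕜 L) (hL' : IsScriptL1 𝕜 L')
    (i : Y →L[𝕜] L) (q : L →L[𝕜] Z) (h : IsShortExactSeq i q)
    (i' : Y' →L[𝕜] L') (q' : L' →L[𝕜] Z) (h' : IsShortExactSeq i' q') :
    HasBAP 𝕜 Y ↔ HasBAP 𝕜 Y' :=
  ⟨HasBAP.of_exact_scriptL1 hL hL' h h', HasBAP.of_exact_scriptL1 hL' hL h' h⟩
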